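/- Let $d,k\ge 0$ be integers and let $G$ be a connected simple graph with vertex set $\{1,\dots,k+1\}$. Write points of $\mathbb R^{d(k+1)}$ as tuples $x=(x^1,\dots,x^{k+1})$ with $x^i\in\mathbb R^d$. For a graph $G'$ on this vertex set let $f_{G'}(x)=(|x^i-x^j|)_{ij\in G'}$ be its distance map and $F_{G'}(x)=(|x^i-x^j|^2)_{ij\in G'}$ its distance-squared map, with coordinates indexed by the edges of $G'$ and $|\cdot|$ the Euclidean norm; let $\Delta(G,\mathbb R^{d(k+1)})=f_G(\mathbb R^{d(k+1)})$. A set $H$ of edges of the complete graph $K_{k+1}$ is independent with respect to $x$ if the rows of the derivative $DF_{K_{k+1}}(x)$ corresponding to the edges in $H$ are linearly independent, and independent in $\mathbb R^d$ if this holds for some $x\in\mathbb R^{d(k+1)}$. A tuple $x$ is generic if every set of edges of $K_{k+1}$ that is independent in $\mathbb R^d$ is independent with respect to $x$. Let $H$ be a maximally independent set of edges of $G$, i.e. a set of edges of $G$ that is independent in $\mathbb R^d$ and is not properly contained in another set of edges of $G$ that is independent in $\mathbb R^d$. Then $$\dim \Delta(G,\mathbb R^{d(k+1)})=|H|,$$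 where $\dim$ is the Hausdorff dimension. Moreover, $|H|$ is the generic rank of the distance map: at every generic tuple $x$ the map $f_G$ is differentiable and its derivative $Df_G(x)$ has rank $|H|$. -/

import Mathlib

open MeasureTheory

noncomputable section

/-- A `(k+1)`-tuple of points of `ℝ^d`, i.e. a point of `ℝ^{d(k+1)}`. -/
abbrev PointTuple (d k : ℕ) : Type := Fin (k + 1) → EuclideanSpace ℝ (Fin d)

/-- The Euclidean distance `|x^i - x^j|` along the unordered pair `{i, j}`. -/
def edgeDist {d k : ℕ} (e : Sym2 (Fin (k + 1))) (x : PointTuple d k) : ℝ :=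
  Sym2.lift ⟨fun i j => ‖x i - x j‖, fun i j => norm_sub_rev (x i) (x j)⟩ e

/-- The distance function `f_G(x) = (|x^i - x^j|)_{ij ∈ G}`, with values in Euclidean space
`ℝ^m`, its coordinates being indexed by the `m` edges of `G`. -/
def distMap {k : ℕ} (d : ℕ) (G : SimpleGraph (Fin (k + 1))) (x : PointTuple d k) :
    EuclideanSpace ℝ G.edgeSet :=
  WithLp.toLp 2 fun e => edgeDist (e : Sym2 (Fin (k + 1))) x

/-- The set `Δ(G, X)` of `G`-distances on a set `X` of tuples. -/
def distSet {d k : ℕ} (G : SimpleGraph (Fin (k + 1))) (X : Set (PointTuple d k)) :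
    Set (EuclideanSpace ℝ G.edgeSet) :=
  distMap d G '' X

/-- The row belonging to the edge `e` of the total derivative, at `x`, of the distance-squared
function `F(x) = (|x^i - x^j|^2)_{ij}`: the derivative at `x` of the coordinate of `F`
with index `e`. -/
def edgeRow {d k : ℕ} (x : PointTuple d k) (e : Sym2 (Fin (k + 1))) :
    PointTuple d k →L[ℝ] ℝ :=
  fderiv ℝ (fun y : PointTuple d k => edgeDist e y ^ 2) x

/-- `H` is independent in `ℝ^d` with respect to `x`. A set containing a degenerate pair `{i, i}`
is never independent, because the row of such a pair is zero. -/
def IndependentAt {d k : ℕ} (x : PointTuple d k) (H : Finset (Sym2 (Fin (k + 1)))) : Prop :=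
  LinearIndepOn ℝ (edgeRow x) (H : Set (Sym2 (Fin (k + 1))))

/-- `H` is independent in `ℝ^d`: it has a witness. -/
def EdgeIndependent {k : ℕ} (d : ℕ) (H : Finset (Sym2 (Fin (k + 1)))) : Prop :=
  ∃ x : PointTuple d k, IndependentAt x H

/-- `H` is a maximally independent (in `ℝ^d`) subset of edges of `G`. -/
def MaximallyIndependent {k : ℕ} (d : ℕ) (G : SimpleGraph (Fin (k + 1)))
    (H : Finset (Sym2 (Fin (k + 1)))) : Prop :=
  Maximal (fun H' : Finset (Sym2 (Fin (k + 1))) =>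
    (H' : Set (Sym2 (Fin (k + 1)))) ⊆ G.edgeSet ∧ EdgeIndependent d H') H

/-- `x` is a generic tuple: it witnesses simultaneously the independence of every
independent set of edges of the complete graph. -/
def GenericTuple {d k : ℕ} (x : PointTuple d k) : Prop :=
  ∀ H : Finset (Sym2 (Fin (k + 1))), EdgeIndependent d H → IndependentAt x H

end

/-!
Squaring turns the distance map into a polynomial map `F`, and the rank of `DF` at a point where
`H` is independent is `|H|`: by maximality every row of an edge of `G` lies in the span of the rows
of `H` (`MaximallyIndependent.edgeRow_mem_span`). Where no edge of `G` has length zero, which is the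
case at every generic tuple unless `d = 0`, the rows of `Df_G` are nonzero multiples of the rows of
`DF_G`, so the two ranks agree (`MaximallyIndependent.rank_distMap`).

For the lower bound on the dimension, `F_H` is a submersion at a witness of `H`, so its image, which
is a smooth image of the distance set, contains an open subset of `ℝ^H`.

The upper bound has to control the image of the tuples at which the rank drops, where the constant
rank theorem says nothing. Instead of a Sard-type theorem, the argument is algebraic. The image of
`F_G` lies in the real zero locus of the ideal `I` of polynomial relations between the squared
distances.
* If the coordinates in `T` are algebraically independent modulo `I`, then by the Jacobian criterion
  (`MvPolynomial.exists_gradient_linearIndependent`) the rows of `T` are linearly independent away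
  from a proper algebraic set, hence at some witness of `H`, and so `|T| ≤ |H|`.
* The real zero locus of an ideal has dimension at most the largest number of coordinates that are
  algebraically independent modulo it (`MvPolynomial.dimH_realZeros_le`). This is a Noetherian
  induction: with `T` maximal independent, every other coordinate `y_e` satisfies a relation
  `p_e(y_T, y_e) = 0` with `∂p_e/∂y_e ∉ I`. Where none of these derivatives vanishes the locus is
  locally a Lipschitz graph over `ℝ^T`, and the rest lies in the loci of strictly larger ideals.

Passing from squared distances back to distances does not raise the dimension, because coordinatewise
square root is locally Lipschitz on each of the finitely many sets of nonnegative vectors with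
prescribed vanishing coordinates (`dimH_le_dimH_image_sq`).
-/

/-! ### Algebraic independence modulo an ideal -/

namespace MvPolynomial

variable {τ σ F : Type*}

theorem vars_pderiv_subset [CommSemiring F] (i : τ) (p : MvPolynomial τ F) :
    (pderiv i p).vars ⊆ p.vars := by
  classical
  intro j hj
  obtain ⟨m, hm, hjm⟩ := (mem_vars_iff_mem_support j).mp hj
  rw [mem_support_iff, coeff_pderiv] at hm
  refine (mem_vars_iff_mem_support j).mpr
    ⟨m + Finsupp.single i 1, mem_support_iff.mpr (left_ne_zero_of_mul hm), ?_⟩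
  rw [Finsupp.mem_support_iff] at hjm ⊢
  simp only [Finsupp.add_apply]
  omega

/-- The chain rule for a derivation applied to a polynomial expression. -/
theorem _root_.Derivation.map_aeval_mvPolynomial [CommRing F] {A M : Type*} [CommRing A]
    [Algebra F A] [AddCommGroup M] [Module A M] [Module F M] [IsScalarTower F A M] [Fintype τ]
    (D : Derivation F A M) (b : τ → A) (p : MvPolynomial τ F) :
    D (aeval b p) = ∑ t, aeval b (pderiv t p) • D (b t) := by
  classical
  induction p using MvPolynomial.induction_on with
  | C a => simp
  | add p q hp hq => simp [hp, hq, add_smul, Finset.sum_add_distrib]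
  | mul_X p i hp =>
    simp only [map_mul, aeval_X, Derivation.leibniz, hp, smul_eq_mul, pderiv_X, map_add, add_smul,
      Finset.sum_add_distrib, mul_smul, Finset.smul_sum]
    congr 1
    rw [Finset.sum_eq_single i]
    · simp
    · intro j _ hj
      simp [hj.symm]
    · simp

/-- The coordinates in `T` are algebraically independent modulo the ideal `I`: the only element
of `I` involving no other variables is zero. -/
def IndepMod [CommSemiring F] (I : Ideal (MvPolynomial τ F)) (T : Finset τ) : Prop :=
  ∀ p ∈ I, p.vars ⊆ T → p = 0

theorem IndepMod.of_le [CommSemiring F] {I J : Ideal (MvPolynomial τ F)} {T : Finset τ}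
    (h : IndepMod J T) (hIJ : I ≤ J) : IndepMod I T :=
  fun p hp => h p (hIJ hp)

theorem indepMod_empty [Field F] {I : Ideal (MvPolynomial τ F)} (hI : I ≠ ⊤) :
    IndepMod I ∅ := by
  intro p hp hv
  rw [Finset.subset_empty] at hv
  rw [vars_eq_empty_iff_eq_C] at hv
  rw [hv] at hp ⊢
  by_contra h
  exact hI (Ideal.eq_top_of_isUnit_mem I hp ((isUnit_iff_ne_zero.mpr (by simpa using h)).map C))

/-- If adjoining the variable `e` destroys independence modulo `I`, this is witnessed by a relation
whose derivative in `e` is no longer a relation: otherwise differentiating in `e` would lower the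
degree in `e` of a nonzero relation until `e` no longer occurs in it. -/
theorem exists_pderiv_notMem [DecidableEq τ] [Field F] [CharZero F]
    {I : Ideal (MvPolynomial τ F)} {T : Finset τ} {e : τ} (hT : IndepMod I T)
    (he : ¬ IndepMod I (insert e T)) :
    ∃ p ∈ I, p.vars ⊆ insert e T ∧ pderiv e p ∉ I := by
  by_contra! H
  refine he fun p hp hv => ?_
  suffices key : ∀ (n : ℕ) (p : MvPolynomial τ F), p ∈ I → p.vars ⊆ insert e T →
      (∀ m ∈ p.support, m e ≤ n) → p = 0 from
    key (p.degreeOf e) p hp hv fun m hm => monomial_le_degreeOf e hm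
  intro n
  induction n with
  | zero =>
    intro p hp hv hd
    refine hT p hp fun j hj => ?_
    rcases Finset.mem_insert.mp (hv hj) with rfl | h
    · obtain ⟨m, hm, hjm⟩ := (mem_vars_iff_mem_support j).mp hj
      exact absurd (Nat.le_zero.mp (hd m hm)) (Finsupp.mem_support_iff.mp hjm)
    · exact h
  | succ n ih =>
    intro p hp hv hd
    have h0 : pderiv e p = 0 := by
      refine ih _ (H p hp hv) ((vars_pderiv_subset e p).trans hv) fun m hm => ?_
      rw [mem_support_iff, coeff_pderiv] at hm
      have := hd _ (mem_support_iff.mpr (left_ne_zero_of_mul hm))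
      simpa using this
    refine hT p hp fun j hj => ?_
    rcases Finset.mem_insert.mp (hv hj) with rfl | h
    · obtain ⟨m, hm, hjm⟩ := (mem_vars_iff_mem_support j).mp hj
      -- In characteristic zero a vanishing derivative leaves no monomial divisible by the variable.
      have h1 : m - Finsupp.single j 1 + Finsupp.single j 1 = m := by
        apply tsub_add_cancel_of_le
        rw [Finsupp.single_le_iff]
        exact Nat.one_le_iff_ne_zero.mpr (Finsupp.mem_support_iff.mp hjm)
      have h2 := coeff_pderiv (i := j) p (m - Finsupp.single j 1)
      rw [h0, h1, coeff_zero] at h2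
      refine absurd h2.symm (mul_ne_zero (mem_support_iff.mp hm)
        (Nat.cast_add_one_ne_zero _))
    · exact h

theorem exists_maximal_indepMod [Finite τ] [CommSemiring F] {I : Ideal (MvPolynomial τ F)}
    {T : Finset τ} (hT : IndepMod I T) : ∃ M, T ⊆ M ∧ Maximal (IndepMod I) M :=
  Finite.exists_le_maximal hT

theorem IndepMod.algebraicIndependent [Field F] {A : Type*} [CommRing A] [Algebra F A]
    {b : τ → A} {T : Finset τ} (hT : IndepMod (RingHom.ker (aeval (R := F) b)) T) :
    AlgebraicIndependent F fun t : T => b t := by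
  classical
  rw [algebraicIndependent_iff]
  intro p hp
  refine (rename_injective ((↑) : T → τ) Subtype.val_injective) ?_
  rw [map_zero]
  refine hT _ ?_ ?_
  · rw [RingHom.mem_ker, aeval_rename]
    exact hp
  · intro j hj
    obtain ⟨i, -, rfl⟩ := Finset.mem_image.mp (vars_rename _ _ hj)
    exact i.2

/-! ### The Jacobian criterion -/

/-- The gradient of a polynomial, as a vector over the field of rational functions. -/
noncomputable def gradFrac (σ F : Type*) [Field F] :
    Derivation F (MvPolynomial σ F) (σ → FractionRing (MvPolynomial σ F)) where
  toFun p i := algebraMap _ _ (pderiv i p)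
  map_add' p q := by ext; simp
  map_smul' c p := by
    ext i
    simp [Algebra.smul_def, IsScalarTower.algebraMap_apply F (MvPolynomial σ F)
      (FractionRing (MvPolynomial σ F))]
  map_one_eq_zero' := by ext; simp
  leibniz' p q := by
    ext i
    simp [Algebra.smul_def]

theorem gradFrac_apply [Field F] (p : MvPolynomial σ F) (i : σ) :
    gradFrac σ F p i = algebraMap _ _ (pderiv i p) := rfl

/-- For a maximal algebraically independent subfamily `M` of a family of polynomials `b`, the gradients
of the members of `M` span those of the whole family: differentiate the relation that expresses the
algebraic dependence of `b e` on `M`. -/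
theorem gradFrac_mem_span [Fintype τ] [Field F] [CharZero F] {b : τ → MvPolynomial σ F}
    {M : Finset τ} (hM : Maximal (IndepMod (RingHom.ker (aeval (R := F) b))) M) (e : τ) :
    gradFrac σ F (b e) ∈ Submodule.span (FractionRing (MvPolynomial σ F))
      (Set.range fun t : M => gradFrac σ F (b t)) := by
  classical
  by_cases he : e ∈ M
  · exact Submodule.subset_span ⟨⟨e, he⟩, rfl⟩
  have hins : ¬ IndepMod (RingHom.ker (aeval (R := F) b)) (insert e M) := fun h =>
    he (hM.2 h (Finset.subset_insert e M) (Finset.mem_insert_self e M))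
  obtain ⟨p, hp, hv, hd⟩ := exists_pderiv_notMem hM.1 hins
  have h := (gradFrac σ F).map_aeval_mvPolynomial b p
  rw [RingHom.mem_ker] at hp hd
  rw [hp, map_zero, ← Finset.add_sum_erase _ _ (Finset.mem_univ e)] at h
  set K := FractionRing (MvPolynomial σ F)
  have hd' : algebraMap (MvPolynomial σ F) K (aeval b (pderiv e p)) ≠ 0 := by
    rwa [Ne, FaithfulSMul.algebraMap_eq_zero_iff]
  rw [← Submodule.smul_mem_iff _ hd', algebraMap_smul, eq_neg_of_add_eq_zero_left h.symm]
  refine Submodule.neg_mem _ (Submodule.sum_mem _ fun t ht => ?_)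
  by_cases htM : t ∈ M
  · rw [← algebraMap_smul K]
    exact Submodule.smul_mem _ _ (Submodule.subset_span ⟨⟨t, htM⟩, rfl⟩)
  · rw [pderiv_eq_zero_of_notMem_vars, map_zero, zero_smul]
    · exact Submodule.zero_mem _
    · intro hc
      rcases Finset.mem_insert.mp (hv hc) with h | h
      · exact (Finset.mem_erase.mp ht).1 h
      · exact htM h

/-- The Jacobian criterion: algebraically independent polynomials have linearly independent gradients
at every point where a certain nonzero polynomial does not vanish. -/
theorem exists_gradient_linearIndependent [Fintype τ] [Fintype σ] [Field F] [CharZero F]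
    (f : τ → MvPolynomial σ F) {T : Finset τ}
    (hT : IndepMod (RingHom.ker (aeval (R := F) f)) T) :
    ∃ q : MvPolynomial σ F, q ≠ 0 ∧ ∀ a : σ → F, eval a q ≠ 0 →
      LinearIndependent F fun t : T => fun i => eval a (pderiv i (f t)) := by
  classical
  -- Once the variables are adjoined to the family, a maximal independent subfamily `M` containing `T`
  -- has gradients spanning the whole space, and at most as many members as there are variables.
  set b : τ ⊕ σ → MvPolynomial σ F := Sum.elim f X with hb
  have hT' : IndepMod (RingHom.ker (aeval (R := F) b)) (T.map .inl) := by
    intro p hp hv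
    have hinj : Function.Injective fun t : T => (Sum.inl (t : τ) : τ ⊕ σ) :=
      Sum.inl_injective.comp Subtype.val_injective
    obtain ⟨p, rfl⟩ := exists_rename_eq_of_vars_subset_range p _ hinj (by
      intro j hj
      obtain ⟨i, hi, rfl⟩ := Finset.mem_map.mp (hv hj)
      exact ⟨⟨i, hi⟩, rfl⟩)
    have h0 : rename ((↑) : T → τ) p = 0 := by
      refine hT _ ?_ fun j hj => ?_
      · rw [RingHom.mem_ker, aeval_rename] at hp ⊢
        exact hp
      · obtain ⟨i, -, rfl⟩ := mem_vars_rename _ _ hj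
        exact i.2
    rw [rename_injective _ Subtype.val_injective (h0.trans (map_zero _).symm), map_zero]
  obtain ⟨M, hTM, hM⟩ := exists_maximal_indepMod hT'
  set K := FractionRing (MvPolynomial σ F)
  have hspan : ⊤ ≤ Submodule.span K (Set.range fun t : M => gradFrac σ F (b t)) := by
    rw [← (Pi.basisFun K σ).span_eq, Submodule.span_le]
    rintro _ ⟨i, rfl⟩
    have := gradFrac_mem_span hM (Sum.inr i)
    have h2 : gradFrac σ F (b (Sum.inr i)) = Pi.basisFun K σ i := by
      ext j
      rw [gradFrac_apply, hb, Sum.elim_inr, pderiv_X, Pi.basisFun_apply]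
      by_cases hij : i = j
      · subst hij; simp
      · simp [hij, Ne.symm hij]
    rwa [h2] at this
  have hcard : Fintype.card M ≤ Fintype.card σ := by
    have := hM.1.algebraicIndependent.lift_cardinalMk_le_trdeg
    rw [MvPolynomial.trdeg_of_isDomain] at this
    simpa using this
  have hcard' : Fintype.card M = Fintype.card σ := by
    refine hcard.antisymm ?_
    have h := finrank_range_le_card (R := K) fun t : M => gradFrac σ F (b t)
    rwa [Set.finrank, top_le_iff.mp hspan, finrank_top, Module.finrank_fintype_fun_eq_card] at h
  have hli : LinearIndependent K fun t : M => gradFrac σ F (b t) :=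
    linearIndependent_of_top_le_span_of_card_eq_finrank hspan
      (by rw [hcard', Module.finrank_fintype_fun_eq_card])
  let ε : M ≃ σ := Fintype.equivOfCardEq hcard'
  let A : Matrix M M (MvPolynomial σ F) := Matrix.of fun t s => pderiv (ε s) (b t)
  refine ⟨A.det, ?_, ?_⟩
  · intro h0
    have h1 : LinearIndependent K (A.map (algebraMap _ K)).row := by
      have := hli.map' (LinearMap.funLeft K K ε)
        (LinearMap.ker_eq_bot.mpr (LinearMap.funLeft_injective_of_surjective K K ε ε.surjective))
      exact this
    rw [Matrix.linearIndependent_rows_iff_isUnit, Matrix.isUnit_iff_isUnit_det,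
      ← RingHom.mapMatrix_apply, ← RingHom.map_det, h0, map_zero] at h1
    exact not_isUnit_zero h1
  · intro a ha
    have h1 : LinearIndependent F (A.map (eval a)).row := by
      rw [Matrix.linearIndependent_rows_iff_isUnit, Matrix.isUnit_iff_isUnit_det,
        ← RingHom.mapMatrix_apply, ← RingHom.map_det]
      exact isUnit_iff_ne_zero.mpr ha
    have h2 : LinearIndependent F fun t : M => fun i => eval a (pderiv i (b t)) := by
      refine LinearIndependent.of_comp (LinearMap.funLeft F F ε) ?_
      exact h1
    exact h2.comp (fun t : T => ⟨Sum.inl t, hTM (Finset.mem_map_of_mem _ t.2)⟩)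
      fun s t h => Subtype.ext (Sum.inl_injective (congrArg Subtype.val h))

end MvPolynomial

/-! ### Hausdorff dimension of real zero loci -/

open Filter Topology in
/-- A map with injective strict derivative at a point is antilipschitz near that point. -/
theorem HasStrictFDerivAt.exists_norm_sub_le_of_injective {E F : Type*} [NormedAddCommGroup E]
    [NormedSpace ℝ E] [FiniteDimensional ℝ E] [NormedAddCommGroup F] [NormedSpace ℝ F]
    {f : E → F} {f' : E →L[ℝ] F} {x : E} (hf : HasStrictFDerivAt f f' x)
    (hinj : Function.Injective f') :
    ∃ s ∈ 𝓝 x, ∃ C : NNReal, ∀ y ∈ s, ∀ z ∈ s, ‖y - z‖ ≤ C * ‖f y - f z‖ := by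
  obtain ⟨K, hK, hKf⟩ := f'.toLinearMap.exists_antilipschitzWith (LinearMap.ker_eq_bot.mpr hinj)
  have hK' : (0 : ℝ) < K := hK
  have hsmall := hf.isLittleO.def (c := 1 / (2 * K)) (by positivity)
  rw [nhds_prod_eq] at hsmall
  obtain ⟨s, hs, h⟩ := mem_prod_self_iff.mp hsmall
  refine ⟨s, hs, 2 * K, fun y hy z hz => ?_⟩
  have h1 : ‖f y - f z - f' (y - z)‖ ≤ 1 / (2 * K) * ‖y - z‖ := @h (y, z) ⟨hy, hz⟩
  have h2 : ‖y - z‖ ≤ K * ‖f' (y - z)‖ := f'.bound_of_antilipschitz hKf (y - z)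
  have h3 : ‖f' (y - z)‖ ≤ ‖f y - f z‖ + 1 / (2 * K) * ‖y - z‖ := by
    refine (norm_le_norm_add_norm_sub' _ (f y - f z)).trans ?_
    gcongr
    rwa [norm_sub_rev]
  have h4 : K * (‖f y - f z‖ + 1 / (2 * K) * ‖y - z‖) = K * ‖f y - f z‖ + ‖y - z‖ / 2 := by
    field_simp
  have h5 := h2.trans (mul_le_mul_of_nonneg_left h3 hK'.le)
  rw [h4] at h5
  push_cast
  linarith

namespace MvPolynomial

variable {τ : Type*} [Fintype τ]

/-- The differential at `a` of a polynomial function. -/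
noncomputable def evalFDeriv (p : MvPolynomial τ ℝ) (a : τ → ℝ) : (τ → ℝ) →L[ℝ] ℝ :=
  ∑ i, eval a (pderiv i p) • ContinuousLinearMap.proj i

theorem evalFDeriv_apply (p : MvPolynomial τ ℝ) (a v : τ → ℝ) :
    evalFDeriv p a v = ∑ i, eval a (pderiv i p) * v i := by
  simp [evalFDeriv]

theorem hasStrictFDerivAt_eval (p : MvPolynomial τ ℝ) (a : τ → ℝ) :
    HasStrictFDerivAt (fun y => eval y p) (evalFDeriv p a) a := by
  classical
  induction p using MvPolynomial.induction_on with
  | C c =>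
    have h1 : (fun y : τ → ℝ => eval y (C c)) = fun _ => c := by ext; simp
    have h2 : evalFDeriv (C c) a = 0 := by ext; simp [evalFDeriv]
    rw [h1, h2]
    exact hasStrictFDerivAt_const c a
  | add p q hp hq =>
    have h1 : (fun y : τ → ℝ => eval y (p + q)) = fun y => eval y p + eval y q := by ext; simp
    have h2 : evalFDeriv (p + q) a = evalFDeriv p a + evalFDeriv q a := by
      ext v
      simp [evalFDeriv_apply, add_mul, Finset.sum_add_distrib, add_apply]
    rw [h1, h2]
    exact hp.add hq
  | mul_X p i hp =>
    have hX : HasStrictFDerivAt (fun y : τ → ℝ => y i) (ContinuousLinearMap.proj i) a :=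
      (ContinuousLinearMap.proj (R := ℝ) (φ := fun _ : τ => ℝ) i).hasStrictFDerivAt
    have h1 : (fun y : τ → ℝ => eval y (p * X i)) = fun y => eval y p * y i := by ext; simp
    have h2 : evalFDeriv (p * X i) a =
        eval a p • ContinuousLinearMap.proj i + a i • evalFDeriv p a := by
      ext1 v
      simp only [evalFDeriv_apply, Derivation.leibniz, pderiv_X, smul_eq_mul, map_add, map_mul,
        eval_X, add_mul, Finset.sum_add_distrib, add_apply, smul_apply, Finset.mul_sum,
        ContinuousLinearMap.proj_apply]
      congr 1
      · rw [Finset.sum_eq_single i]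
        · simp
        · intro j _ hj
          simp [hj.symm]
        · simp
      · exact Finset.sum_congr rfl fun j _ => by ring
    rw [h1, h2]
    exact hp.mul hX

/-- The real zero locus of an ideal of polynomials. -/
def realZeros (I : Ideal (MvPolynomial τ ℝ)) : Set (τ → ℝ) :=
  {y | ∀ p ∈ I, eval y p = 0}

/-- A set on which each coordinate `e ∉ T` is a simple root of a polynomial in `y_e` with coefficients
depending on the coordinates in `T` has dimension at most `|T|`. -/
theorem dimH_le_of_eval_pderiv_ne_zero {S : Set (τ → ℝ)} (T : Finset τ)
    (p : τ → MvPolynomial τ ℝ) (hS : ∀ e ∉ T, ∀ y ∈ S, eval y (p e) = 0)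
    (hv : ∀ e ∉ T, ∀ i ∈ (p e).vars, i = e ∨ i ∈ T)
    (hd : ∀ e ∉ T, ∀ y ∈ S, eval y (pderiv e (p e)) ≠ 0) :
    dimH S ≤ T.card := by
  classical
  by_contra! hlt
  obtain ⟨x, hx, hxt⟩ := exists_mem_nhdsWithin_lt_dimH_of_lt_dimH hlt
  -- The map replacing each coordinate outside `T` by the polynomial that determines it is
  -- antilipschitz near `x`, and on `S` it only retains the coordinates in `T`.
  let q : τ → MvPolynomial τ ℝ := fun e => if e ∈ T then X e else p e
  have hΦ : HasStrictFDerivAt (fun y : τ → ℝ => fun e => eval y (q e))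
      (ContinuousLinearMap.pi fun e => evalFDeriv (q e) x) x :=
    hasStrictFDerivAt_pi.mpr fun e => hasStrictFDerivAt_eval (q e) x
  have hinj : Function.Injective (ContinuousLinearMap.pi fun e => evalFDeriv (q e) x) := by
    rw [injective_iff_map_eq_zero]
    intro v hv0
    have hq : ∀ e, evalFDeriv (q e) x v = 0 := fun e => congrFun hv0 e
    have hvT : ∀ e ∈ T, v e = 0 := by
      intro e he
      have := hq e
      simp only [q, if_pos he, evalFDeriv_apply] at this
      rw [Finset.sum_eq_single e] at this
      · simpa using this
      · intro j _ hj
        simp [hj.symm]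
      · simp
    ext e
    by_cases he : e ∈ T
    · exact hvT e he
    have := hq e
    simp only [q, if_neg he, evalFDeriv_apply] at this
    rw [Finset.sum_eq_single e] at this
    · exact (mul_eq_zero.mp this).resolve_left (hd e he x hx)
    · intro j _ hj
      by_cases hjT : j ∈ T
      · rw [hvT j hjT, mul_zero]
      · rw [pderiv_eq_zero_of_notMem_vars, map_zero, zero_mul]
        exact fun hc => (hv e he j hc).elim hj hjT
    · simp
  obtain ⟨s, hs, C, hC⟩ := hΦ.exists_norm_sub_le_of_injective hinj
  refine (hxt (S ∩ s) (Filter.inter_mem self_mem_nhdsWithin (mem_nhdsWithin_of_mem_nhds hs))).not_ge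
    ?_
  have hanti : AntilipschitzWith C fun y : (S ∩ s : Set (τ → ℝ)) => fun t : T => (y : τ → ℝ) t := by
    refine AntilipschitzWith.of_le_mul_dist fun y z => ?_
    rw [Subtype.dist_eq, dist_eq_norm, dist_eq_norm]
    refine (hC y y.2.2 z z.2.2).trans (mul_le_mul_of_nonneg_left ?_ C.2)
    rw [pi_norm_le_iff_of_nonneg (norm_nonneg _)]
    intro e
    by_cases he : e ∈ T
    · have := norm_le_pi_norm
        ((fun t : T => (y : τ → ℝ) t) - fun t : T => (z : τ → ℝ) t) ⟨e, he⟩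
      simpa [q, he] using this
    · simp [q, he, hS e he y y.2.1, hS e he z z.2.1]
  calc dimH (S ∩ s) = dimH (Set.univ : Set (S ∩ s : Set (τ → ℝ))) := by
        rw [← Isometry.dimH_image (f := ((↑) : (S ∩ s : Set (τ → ℝ)) → τ → ℝ))
          (fun _ _ => rfl) Set.univ, Set.image_univ, Subtype.range_coe]
    _ ≤ dimH ((fun y : (S ∩ s : Set (τ → ℝ)) => fun t : T => (y : τ → ℝ) t) '' Set.univ) :=
        hanti.le_dimH_image _
    _ ≤ dimH (Set.univ : Set (T → ℝ)) := dimH_mono (Set.subset_univ _)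
    _ = T.card := by rw [Real.dimH_univ_pi, Fintype.card_coe]

/-- The real zero locus of `I` has Hausdorff dimension at most the largest number of coordinates that
are algebraically independent modulo `I`. -/
theorem dimH_realZeros_le (r : ℕ) (I : Ideal (MvPolynomial τ ℝ))
    (hr : ∀ T : Finset τ, IndepMod I T → T.card ≤ r) : dimH (realZeros I) ≤ r := by
  classical
  induction I using WellFoundedGT.induction with
  | ind I ih =>
    by_cases hI : I = ⊤
    · have : realZeros I = ∅ := by
        ext y
        simp only [realZeros, hI, Set.mem_ofPred_eq, Set.mem_empty_iff_false, iff_false]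
        exact fun h => one_ne_zero ((map_one (eval y)).symm.trans (h 1 trivial))
      simp [this]
    obtain ⟨T, -, hT⟩ := exists_maximal_indepMod (indepMod_empty hI)
    have hex : ∀ e ∉ T, ∃ p ∈ I, p.vars ⊆ insert e T ∧ pderiv e p ∉ I := fun e he =>
      exists_pderiv_notMem hT.1 fun h =>
        he (hT.2 h (Finset.subset_insert e T) (Finset.mem_insert_self e T))
    choose! p hpI hpv hpd using hex
    let J : τ → Ideal (MvPolynomial τ ℝ) := fun e => I ⊔ Ideal.span {pderiv e (p e)}
    have hcover : realZeros I ⊆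
        {y ∈ realZeros I | ∀ e ∉ T, eval y (pderiv e (p e)) ≠ 0} ∪
          ⋃ e ∈ {e | e ∉ T}, realZeros (J e) := by
      intro y hy
      by_cases h : ∀ e ∉ T, eval y (pderiv e (p e)) ≠ 0
      · exact Or.inl ⟨hy, h⟩
      push Not at h
      obtain ⟨e, he, h0⟩ := h
      refine Or.inr (Set.mem_biUnion he ?_)
      have : J e ≤ RingHom.ker (eval y) := by
        refine sup_le (fun g hg => hy g hg) ?_
        rw [Ideal.span_singleton_le_iff_mem]
        exact h0
      exact fun g hg => this hg
    refine (dimH_mono hcover).trans ?_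
    rw [dimH_union, dimH_bUnion (Set.to_countable _)]
    refine max_le ?_ (iSup₂_le fun e he => ?_)
    · refine (dimH_le_of_eval_pderiv_ne_zero T p (fun e he y hy => hy.1 _ (hpI e he))
        (fun e he i hi => Finset.mem_insert.mp (hpv e he hi)) fun e he y hy => hy.2 e he).trans ?_
      exact_mod_cast hr T hT.1
    · have hlt : I < J e := by
        refine lt_of_le_of_ne le_sup_left fun h => hpd e he ?_
        rw [h]
        exact Ideal.mem_sup_right (Ideal.mem_span_singleton_self _)
      exact ih (J e) hlt fun T' hT' => hr T' (hT'.of_le hlt.le)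

theorem dense_setOf_eval_ne_zero {q : MvPolynomial τ ℝ} (hq : q ≠ 0) :
    Dense {a : τ → ℝ | eval a q ≠ 0} := by
  intro a
  rw [Metric.mem_closure_iff]
  intro ε hε
  by_contra! H
  refine hq (funext_set (fun i => Metric.ball (a i) ε) (fun i => ?_) fun b hb => ?_)
  · rw [Real.ball_eq_Ioo]
    exact Set.Ioo_infinite (by linarith)
  · rw [map_zero]
    by_contra hne
    refine (H b hne).not_gt ?_
    rw [dist_pi_lt_iff hε]
    intro i
    rw [dist_comm]
    exact hb i trivial

end MvPolynomial

/-! ### Two facts about Euclidean spaces -/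

/-- Coordinatewise squaring does not lower the dimension of a set of nonnegative vectors. -/
theorem dimH_le_dimH_image_sq {ι : Type*} [Fintype ι] {Z : Set (EuclideanSpace ℝ ι)}
    (hZ : ∀ y ∈ Z, ∀ i, 0 ≤ y i) :
    dimH Z ≤ dimH ((fun (y : EuclideanSpace ℝ ι) (i : ι) => y i ^ 2) '' Z) := by
  classical
  set W := (fun (y : EuclideanSpace ℝ ι) (i : ι) => y i ^ 2) '' Z
  let g : Finset ι → (ι → ℝ) → EuclideanSpace ℝ ι := fun S w =>
    WithLp.toLp 2 fun i => if i ∈ S then √(w i) else 0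
  -- The square root is not Lipschitz at zero, so `Z` is split by which coordinates vanish.
  have hcover : Z ⊆ ⋃ S : Finset ι, g S '' {w ∈ W | ∀ i ∈ S, w i ≠ 0} := by
    intro y hy
    refine Set.mem_iUnion.mpr
      ⟨Finset.univ.filter fun i => y i ≠ 0, fun i => y i ^ 2, ⟨⟨y, hy, rfl⟩, ?_⟩, ?_⟩
    · intro i hi
      exact pow_ne_zero 2 (by simpa using hi)
    · ext i
      by_cases h : y i = 0
      · simp [g, h]
      · simp [g, h, Real.sqrt_sq (hZ y hy i)]
  refine (dimH_mono hcover).trans ?_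
  rw [dimH_iUnion]
  refine iSup_le fun S => (dimH_image_le_of_locally_lipschitzOn fun w hw => ?_).trans
    (dimH_mono (Set.sep_subset _ _))
  have hg : ContDiffAt ℝ 1 (g S) w := by
    rw [contDiffAt_euclidean]
    intro i
    by_cases hi : i ∈ S
    · simp only [g, hi, if_true]
      exact (contDiff_apply ℝ ℝ i).contDiffAt.sqrt (hw.2 i hi)
    · simp only [g, hi, if_false]
      exact contDiffAt_const
  obtain ⟨K, t, ht, hK⟩ := hg.exists_lipschitzOnWith
  exact ⟨K, t, mem_nhdsWithin_of_mem_nhds ht, hK⟩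

/-- Row rank equals column rank, for a finite family of functionals. -/
theorem ContinuousLinearMap.finrank_range_pi {E ι : Type*} [NormedAddCommGroup E] [NormedSpace ℝ E]
    [FiniteDimensional ℝ E] [Fintype ι] (φ : ι → E →L[ℝ] ℝ) :
    Module.finrank ℝ (LinearMap.range (ContinuousLinearMap.pi φ).toLinearMap) =
      Module.finrank ℝ (Submodule.span ℝ (Set.range φ)) := by
  classical
  set L : E →ₗ[ℝ] ι → ℝ := (ContinuousLinearMap.pi φ).toLinearMap
  let c : (E →L[ℝ] ℝ) ≃ₗ[ℝ] Module.Dual ℝ E := LinearMap.toContinuousLinearMap.symm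
  have h : LinearMap.range L.dualMap =
      (Submodule.span ℝ (Set.range φ)).map (c : (E →L[ℝ] ℝ) →ₗ[ℝ] Module.Dual ℝ E) := by
    rw [LinearMap.range_eq_map, ← (Pi.basisFun ℝ ι).dualBasis.span_eq, Submodule.map_span,
      Submodule.map_span, ← Set.range_comp, ← Set.range_comp]
    congr 2
    ext i v
    simp [L, c]
  rw [← LinearMap.finrank_range_dualMap_eq_finrank_range, h, LinearEquiv.finrank_map_eq]

/-! ### The rows of the derivative of the squared distances -/

section Framework

variable {d k : ℕ}

/-- The identification of tuples of points with their vectors of coordinates. -/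
noncomputable def coordEquiv (d k : ℕ) : PointTuple d k ≃L[ℝ] (Fin (k + 1) × Fin d → ℝ) :=
  LinearEquiv.toContinuousLinearEquiv
    { toFun := fun x s => x s.1 s.2
      invFun := fun a i => WithLp.toLp 2 fun c => a (i, c)
      map_add' := fun _ _ => rfl
      map_smul' := fun _ _ => rfl
      left_inv := fun _ => rfl
      right_inv := fun _ => rfl }

theorem coordEquiv_apply (x : PointTuple d k) (s : Fin (k + 1) × Fin d) :
    coordEquiv d k x s = x s.1 s.2 := rfl

/-- The squared distance along an edge, as a polynomial in the coordinates of the points. -/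
noncomputable def edgePoly (d : ℕ) {k : ℕ} (e : Sym2 (Fin (k + 1))) :
    MvPolynomial (Fin (k + 1) × Fin d) ℝ :=
  Sym2.lift ⟨fun i j => ∑ c, (MvPolynomial.X (i, c) - MvPolynomial.X (j, c)) ^ 2,
    fun i j => Finset.sum_congr rfl fun c _ => by ring⟩ e

theorem eval_edgePoly (e : Sym2 (Fin (k + 1))) (x : PointTuple d k) :
    MvPolynomial.eval (coordEquiv d k x) (edgePoly d e) = edgeDist e x ^ 2 := by
  induction e using Sym2.ind with
  | _ i j => simp [edgePoly, edgeDist, EuclideanSpace.norm_sq_eq, coordEquiv_apply]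

theorem edgeDist_nonneg (e : Sym2 (Fin (k + 1))) (x : PointTuple d k) : 0 ≤ edgeDist e x := by
  induction e using Sym2.ind with
  | _ i j => exact norm_nonneg (x i - x j)

theorem hasStrictFDerivAt_edgeDist_sq (e : Sym2 (Fin (k + 1))) (x : PointTuple d k) :
    HasStrictFDerivAt (fun y : PointTuple d k => edgeDist e y ^ 2)
      ((MvPolynomial.evalFDeriv (edgePoly d e) (coordEquiv d k x)).comp
        (coordEquiv d k : PointTuple d k →L[ℝ] (Fin (k + 1) × Fin d → ℝ))) x := by
  simp_rw [← eval_edgePoly]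
  exact (MvPolynomial.hasStrictFDerivAt_eval _ _).comp x (coordEquiv d k).hasStrictFDerivAt

theorem edgeRow_eq_comp (x : PointTuple d k) (e : Sym2 (Fin (k + 1))) :
    edgeRow x e = (MvPolynomial.evalFDeriv (edgePoly d e) (coordEquiv d k x)).comp
        (coordEquiv d k : PointTuple d k →L[ℝ] (Fin (k + 1) × Fin d → ℝ)) :=
  (hasStrictFDerivAt_edgeDist_sq e x).hasFDerivAt.fderiv

theorem hasStrictFDerivAt_edgeRow (e : Sym2 (Fin (k + 1))) (x : PointTuple d k) :
    HasStrictFDerivAt (fun y : PointTuple d k => edgeDist e y ^ 2) (edgeRow x e) x := by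
  rw [edgeRow_eq_comp]
  exact hasStrictFDerivAt_edgeDist_sq e x

theorem edgeRow_mk_apply (x v : PointTuple d k) (i j : Fin (k + 1)) :
    edgeRow x s(i, j) v = 2 * inner ℝ (x i - x j) (v i - v j) := by
  have h : HasFDerivAt (fun y : PointTuple d k => y i - y j)
      (ContinuousLinearMap.proj (R := ℝ) (φ := fun _ : Fin (k + 1) => EuclideanSpace ℝ (Fin d)) i -
        ContinuousLinearMap.proj j) x :=
    (ContinuousLinearMap.proj (R := ℝ) (φ := fun _ : Fin (k + 1) => EuclideanSpace ℝ (Fin d)) i -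
        ContinuousLinearMap.proj j).hasFDerivAt
  have h2 : edgeRow x s(i, j) = _ := h.norm_sq.fderiv
  rw [h2]
  change 2 • (inner ℝ (x i - x j) (v i - v j) : ℝ) = _
  rw [two_nsmul, two_mul]

theorem edgeRow_eq_zero_of_edgeDist_eq_zero {x : PointTuple d k} {e : Sym2 (Fin (k + 1))}
    (h : edgeDist e x = 0) : edgeRow x e = 0 := by
  induction e using Sym2.ind with
  | _ i j =>
    have h0 : x i - x j = 0 := norm_eq_zero.mp h
    ext v
    simp [edgeRow_mk_apply, h0]

theorem continuous_edgeRow (e : Sym2 (Fin (k + 1))) :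
    Continuous fun x : PointTuple d k => edgeRow x e := by
  simp_rw [edgeRow_eq_comp]
  refine Continuous.clm_comp ?_ continuous_const
  unfold MvPolynomial.evalFDeriv
  exact continuous_finsetSum _ fun i _ =>
    ((MvPolynomial.continuous_eval _).comp (coordEquiv d k).continuous).smul continuous_const

theorem isOpen_setOf_independentAt (H : Finset (Sym2 (Fin (k + 1)))) :
    IsOpen {x : PointTuple d k | IndependentAt x H} :=
  isOpen_setOfPred_linearIndependent.preimage (f := fun (x : PointTuple d k) (e : H) => edgeRow x e)
    (continuous_pi fun e => continuous_edgeRow e.1)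

theorem edgeIndependent_singleton (hd : 0 < d) {e : Sym2 (Fin (k + 1))} (he : ¬ e.IsDiag) :
    EdgeIndependent d {e} := by
  induction e using Sym2.ind with
  | _ i j =>
    have hij : i ≠ j := he
    let x : PointTuple d k := Pi.single i (EuclideanSpace.single ⟨0, hd⟩ 1)
    have hx : x i - x j = EuclideanSpace.single ⟨0, hd⟩ 1 := by
      simp [x, hij.symm]
    refine ⟨x, ?_⟩
    rw [IndependentAt, Finset.coe_singleton, linearIndepOn_singleton_iff]
    intro h0
    have := edgeRow_mk_apply x x i j
    rw [h0, hx] at this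
    simp at this

/-! ### Maximally independent sets of edges -/

variable {G : SimpleGraph (Fin (k + 1))} {H : Finset (Sym2 (Fin (k + 1)))}

theorem MaximallyIndependent.edgeRow_mem_span (hH : MaximallyIndependent d G H)
    {x : PointTuple d k} (hx : IndependentAt x H) {e : Sym2 (Fin (k + 1))} (he : e ∈ G.edgeSet) :
    edgeRow x e ∈ Submodule.span ℝ (edgeRow x '' (H : Set (Sym2 (Fin (k + 1))))) := by
  classical
  by_contra hn
  have heH : e ∉ H := fun h => hn (Submodule.subset_span ⟨e, h, rfl⟩)
  have hi : IndependentAt x (insert e H) := by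
    rw [IndependentAt, Finset.coe_insert]
    exact LinearIndepOn.insert hx hn
  refine heH (hH.2 ⟨?_, x, hi⟩ (Finset.subset_insert e H) (Finset.mem_insert_self e H))
  rw [Finset.coe_insert]
  exact Set.insert_subset he hH.1.1

theorem IndependentAt.finrank_span {x : PointTuple d k} (hx : IndependentAt x H) :
    Module.finrank ℝ (Submodule.span ℝ (edgeRow x '' (H : Set (Sym2 (Fin (k + 1)))))) = H.card := by
  have := finrank_span_eq_card (R := ℝ) (b := fun e : H => edgeRow x e) hx
  rw [Fintype.card_coe] at this
  rw [← this, Set.image_eq_range]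
  rfl

theorem MaximallyIndependent.finrank_span_edgeSet (hH : MaximallyIndependent d G H)
    {x : PointTuple d k} (hx : IndependentAt x H) :
    Module.finrank ℝ (Submodule.span ℝ (Set.range fun e : G.edgeSet => edgeRow x e)) = H.card := by
  rw [← hx.finrank_span]
  suffices h : Submodule.span ℝ (Set.range fun e : G.edgeSet => edgeRow x e) =
      Submodule.span ℝ (edgeRow x '' (H : Set (Sym2 (Fin (k + 1))))) by rw [h]
  refine le_antisymm (Submodule.span_le.mpr ?_) (Submodule.span_mono ?_)
  · rintro _ ⟨e, rfl⟩
    exact hH.edgeRow_mem_span hx e.2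
  · rintro _ ⟨e, he, rfl⟩
    exact ⟨⟨e, hH.1.1 he⟩, rfl⟩

/-- A set of edges of `G` whose squared distances are algebraically independent has at most `|H|`
elements. -/
theorem MaximallyIndependent.card_le_of_indepMod [Fintype G.edgeSet]
    (hH : MaximallyIndependent d G H) {T : Finset G.edgeSet}
    (hT : MvPolynomial.IndepMod
      (RingHom.ker (MvPolynomial.aeval (R := ℝ) fun e : G.edgeSet => edgePoly d e.1)) T) :
    T.card ≤ H.card := by
  classical
  obtain ⟨q, hq, hqT⟩ := MvPolynomial.exists_gradient_linearIndependent _ hT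
  have hdense : Dense {x : PointTuple d k | MvPolynomial.eval (coordEquiv d k x) q ≠ 0} :=
    (MvPolynomial.dense_setOf_eval_ne_zero hq).preimage (coordEquiv d k).toHomeomorph.isOpenMap
  -- The independent tuples for `H` form a nonempty open set, so one of them also witnesses `T`.
  obtain ⟨x, hxH, hxq⟩ :=
    hdense.inter_open_nonempty _ (isOpen_setOf_independentAt H) hH.1.2
  have hli : LinearIndependent ℝ fun t : T => edgeRow x (t : G.edgeSet) := by
    -- `Λ` reads off the partial derivatives from a functional.
    let Λ : (PointTuple d k →L[ℝ] ℝ) →ₗ[ℝ] (Fin (k + 1) × Fin d → ℝ) :=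
      { toFun := fun φ i => φ ((coordEquiv d k).symm (Pi.single i 1))
        map_add' := fun _ _ => rfl
        map_smul' := fun _ _ => rfl }
    refine LinearIndependent.of_comp Λ ?_
    have hΛ : (Λ ∘ fun t : T => edgeRow x (t : G.edgeSet).1) = fun (t : T) i =>
        MvPolynomial.eval (coordEquiv d k x)
          (MvPolynomial.pderiv i (edgePoly d (t : G.edgeSet).1)) := by
      ext t i
      simp [Λ, edgeRow_eq_comp, MvPolynomial.evalFDeriv_apply, Pi.single_apply]
    rw [hΛ]
    exact hqT (coordEquiv d k x) hxq
  have h1 := finrank_span_eq_card hli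
  rw [Fintype.card_coe] at h1
  rw [← h1, ← hxH.finrank_span]
  refine Submodule.finrank_mono (Submodule.span_le.mpr ?_)
  rintro _ ⟨t, rfl⟩
  exact hH.edgeRow_mem_span hxH t.1.2

theorem MaximallyIndependent.dimH_distSet_le [Fintype G.edgeSet]
    (hH : MaximallyIndependent d G H) :
    dimH (distSet G (Set.univ : Set (PointTuple d k))) ≤ H.card := by
  refine (dimH_le_dimH_image_sq ?_).trans ((dimH_mono ?_).trans
    (MvPolynomial.dimH_realZeros_le H.card _ fun T hT => hH.card_le_of_indepMod hT))
  · rintro _ ⟨x, -, rfl⟩ e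
    exact edgeDist_nonneg _ x
  · rintro _ ⟨_, ⟨x, -, rfl⟩, rfl⟩ p hp
    have h := congrArg (MvPolynomial.eval (coordEquiv d k x)) ((RingHom.mem_ker).mp hp)
    have heval : ∀ q : MvPolynomial G.edgeSet ℝ,
        MvPolynomial.eval (coordEquiv d k x)
            (MvPolynomial.aeval (fun e : G.edgeSet => edgePoly d e.1) q) =
          MvPolynomial.eval (fun e : G.edgeSet => edgeDist e.1 x ^ 2) q := by
      intro q
      induction q using MvPolynomial.induction_on with
      | C c => simp
      | add p q hp hq => rw [map_add, map_add, map_add, hp, hq]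
      | mul_X p e hp => rw [map_mul, map_mul, map_mul, hp, MvPolynomial.aeval_X,
          MvPolynomial.eval_X, eval_edgePoly]
    rw [map_zero, heval] at h
    exact h

theorem MaximallyIndependent.le_dimH_distSet [Fintype G.edgeSet]
    (hH : MaximallyIndependent d G H) :
    (H.card : ENNReal) ≤ dimH (distSet G (Set.univ : Set (PointTuple d k))) := by
  obtain ⟨x, hx⟩ := hH.1.2
  let φ : PointTuple d k →L[ℝ] H → ℝ := ContinuousLinearMap.pi fun e : H => edgeRow x e
  have hF : HasStrictFDerivAt (fun (y : PointTuple d k) (e : H) => edgeDist e.1 y ^ 2) φ x :=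
    hasStrictFDerivAt_pi.mpr fun e => hasStrictFDerivAt_edgeRow e.1 x
  have hφ : φ.range = ⊤ := by
    refine Submodule.eq_top_of_finrank_eq ?_
    have h1 := finrank_span_eq_card (R := ℝ) (b := fun e : H => edgeRow x e) hx
    have h2 := ContinuousLinearMap.finrank_range_pi fun e : H => edgeRow x e
    rw [Module.finrank_fintype_fun_eq_card]
    exact h2.trans h1
  have hnhds : Set.range (fun (y : PointTuple d k) (e : H) => edgeDist e.1 y ^ 2) ∈
      nhds fun e : H => edgeDist e.1 x ^ 2 := by
    rw [← hF.map_nhds_eq_of_surj hφ]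
    exact Filter.range_mem_map
  have hdim := Real.dimH_of_mem_nhds hnhds
  rw [Module.finrank_fintype_fun_eq_card, Fintype.card_coe] at hdim
  let π : EuclideanSpace ℝ G.edgeSet → H → ℝ := fun y e => y ⟨e, hH.1.1 e.2⟩ ^ 2
  have hπ : ContDiff ℝ 1 π := by
    rw [contDiff_pi]
    intro e
    exact ((contDiff_euclidean.mp contDiff_id) _).pow 2
  calc (H.card : ENNReal) = _ := hdim.symm
    _ ≤ dimH (π '' distSet G Set.univ) := by
        refine dimH_mono ?_
        rintro _ ⟨y, rfl⟩
        exact ⟨_, ⟨y, trivial, rfl⟩, rfl⟩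
    _ ≤ _ := hπ.contDiffOn.dimH_image_le convex_univ (Set.subset_univ _)

/-- The derivative of the distance map at a tuple at which no edge of `G` has length zero. -/
theorem hasFDerivAt_distMap [Fintype G.edgeSet] {x : PointTuple d k}
    (hx : ∀ e ∈ G.edgeSet, edgeDist e x ≠ 0) :
    HasFDerivAt (distMap d G)
      (((EuclideanSpace.equiv G.edgeSet ℝ).symm :
          (G.edgeSet → ℝ) →L[ℝ] EuclideanSpace ℝ G.edgeSet).comp
        (ContinuousLinearMap.pi fun e : G.edgeSet =>
          (1 / (2 * edgeDist (e : Sym2 (Fin (k + 1))) x)) • edgeRow x e)) x := by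
  refine (EuclideanSpace.equiv G.edgeSet ℝ).symm.hasFDerivAt.comp x (hasFDerivAt_pi.mpr fun e => ?_)
  have h := (hasStrictFDerivAt_edgeRow e.1 x).hasFDerivAt.sqrt (pow_ne_zero 2 (hx e e.2))
  simpa only [Real.sqrt_sq (edgeDist_nonneg _ _)] using h

theorem MaximallyIndependent.rank_distMap [Fintype G.edgeSet]
    (hH : MaximallyIndependent d G H) {x : PointTuple d k} (hx : GenericTuple x) :
    DifferentiableAt ℝ (distMap d G) x ∧
      Module.finrank ℝ (LinearMap.range (fderiv ℝ (distMap d G) x).toLinearMap) = H.card := by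
  have hHx : IndependentAt x H := hx H hH.1.2
  -- For `d = 0` all distances vanish identically, and there is only one tuple.
  rcases Nat.eq_zero_or_pos d with rfl | hd
  · refine ⟨(hasFDerivAt_of_subsingleton _ x).differentiableAt, ?_⟩
    have h0 : H = ∅ := Finset.eq_empty_of_forall_notMem fun e he =>
      hHx.ne_zero he (by ext v; rw [Subsingleton.elim v 0, map_zero, map_zero])
    rw [(hasFDerivAt_of_subsingleton _ x).fderiv, h0]
    simp
  have hne : ∀ e ∈ G.edgeSet, edgeDist e x ≠ 0 := by
    intro e he h0
    have h1 := hx {e} (edgeIndependent_singleton hd (G.not_isDiag_of_mem_edgeSet he))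
    rw [IndependentAt, Finset.coe_singleton, linearIndepOn_singleton_iff] at h1
    exact h1 (edgeRow_eq_zero_of_edgeDist_eq_zero h0)
  have hD := hasFDerivAt_distMap hne
  refine ⟨hD.differentiableAt, ?_⟩
  have hspan : Submodule.span ℝ (Set.range fun e : G.edgeSet =>
        (1 / (2 * edgeDist e.1 x)) • edgeRow x e.1) =
      Submodule.span ℝ (Set.range fun e : G.edgeSet => edgeRow x e.1) := by
    refine le_antisymm (Submodule.span_le.mpr ?_) (Submodule.span_le.mpr ?_)
    · rintro _ ⟨e, rfl⟩
      exact Submodule.smul_mem _ _ (Submodule.subset_span ⟨e, rfl⟩)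
    · rintro _ ⟨e, rfl⟩
      have hc : 1 / (2 * edgeDist e.1 x) ≠ 0 :=
        one_div_ne_zero (mul_ne_zero two_ne_zero (hne e e.2))
      exact (Submodule.smul_mem_iff _ hc).mp (Submodule.subset_span ⟨e, rfl⟩)
  rw [hD.fderiv, ← hH.finrank_span_edgeSet hHx, ← hspan, ← ContinuousLinearMap.finrank_range_pi,
    ContinuousLinearMap.toLinearMap_comp, LinearMap.range_comp]
  exact LinearEquiv.finrank_map_eq (EuclideanSpace.equiv G.edgeSet ℝ).symm.toLinearEquiv _

end Framework

/-! ### Dimension and generic rank -/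

theorem theorem3 (d k : ℕ) (G : SimpleGraph (Fin (k + 1))) [DecidableRel G.Adj]
    (hG : G.Connected) (H : Finset (Sym2 (Fin (k + 1))))
    (hH : MaximallyIndependent d G H) :
    dimH (distSet G (Set.univ : Set (PointTuple d k))) = (H.card : ENNReal) ∧
      ∀ x : PointTuple d k, GenericTuple x →
        DifferentiableAt ℝ (distMap d G) x ∧
          Module.finrank ℝ (LinearMap.range (fderiv ℝ (distMap d G) x).toLinearMap) = H.card :=
  ⟨le_antisymm hH.dimH_distSet_le hH.le_dimH_distSet, fun _ hx => hH.rank_distMap hx⟩
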